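/- Call a sequence of integers $(k_j)_{j\ge 0}$ a base sequence if $0=k_0<k_1<k_2<\cdots$. Call a sequence $M=(M_j)_{j\ge 0}$ of positive reals a weight sequence if $M_0=1\le M_1\le \mu_2\le\mu_3\le\cdots$, where $\mu_j:=M_j/M_{j-1}$. Put $m_j:=M_j^{1/j}$ for $j\ge1$ and $m_0:=1$. The weight sequence $M$ has moderate growth if $\sup_{j,k\ge1}\bigl(M_{j+k}/(M_jM_k)\bigr)^{1/(j+k)}<\infty$. For real- or complex-valued functions on $\mathbb R^n$, the Gelfand–Shilov class $\mathcal S^{\{M\}}(\mathbb R^n)$ (resp. $\mathcal S^{(M)}(\mathbb R^n)$) is the set of all $f\in C^\infty(\mathbb R^n)$ such that there exist $\rho,\sigma>0$ such that (resp. for all $\rho,\sigma>0$) $$\sup_{\alpha,\beta\in\mathbb N^n}\ \sup_{x\in\mathbb R^n}\frac{|x^\alpha\partial^\beta f(x)|}{(\rho m_{|\alpha|})^{|\alpha|}(\sigma m_{|\beta|})^{|\beta|}}<\infty .$$ For base sequences $(k_j)$ and $(\ell_j)$, the lacunary Gelfand–Shilov class $\mathcal S^{\{M\}}_{(k_j),(\ell_j)}(\mathbb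 R^n)$ (resp. $\mathcal S^{(M)}_{(k_j),(\ell_j)}(\mathbb R^n)$) is the set of all $f\in C^\infty(\mathbb R^n)$ such that there exist $C,\rho,\sigma>0$ such that (resp. for all $\rho,\sigma>0$ there is $C>0$ such that) $$\max_{|\alpha|=k_j}\sup_{x}|x^\alpha f(x)|\le C(\rho m_{k_j})^{k_j}\quad\text{and}\quad \max_{|\beta|=\ell_j}\sup_{x}|\partial^\beta f(x)|\le C(\sigma m_{\ell_j})^{\ell_j}\qquad\text{for all } j\ge0 .$$ Theorem. Let $(k_j)$ and $(\ell_j)$ be base sequences and let $M$ be a weight sequence of moderate growth. Assume that $m_{k_{j+1}}/m_{k_j}$ and $m_{\ell_{j+1}}/m_{\ell_j}$, $j\ge0$, are bounded. Then: (a) $\mathcal S^{\{M\}}_{(k_j),(\ell_j)}(\mathbb R^n)=\mathcal S^{\{M\}}(\mathbb R^n)$ provided that $j/m_j$ is bounded. (b) $\mathcal S^{(M)}_{(k_j),(\ell_j)}(\mathbb R^n)=\mathcal S^{(M)}(\mathbb R^n)$ provided that $j/m_j\to0$ as $j\to\infty$. -/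

import Mathlib

open Set Filter Topology
open scoped ContDiff

/-- A base sequence: `0 = k 0 < k 1 < k 2 < ⋯`, a strictly increasing sequence of integers. -/
structure IsBaseSequence (k : ℕ → ℕ) : Prop where
  zero : k 0 = 0
  strictMono : StrictMono k

/-- A weight sequence: a positive sequence with `M 0 = 1 ≤ M 1 ≤ μ 2 ≤ μ 3 ≤ ⋯`,
where `μ k = M k / M (k - 1)` (note that `μ 1 = M 1`, since `M 0 = 1`). -/
structure IsWeightSequence (M : ℕ → ℝ) : Prop where
  pos : ∀ k, 0 < M k
  zero : M 0 = 1
  one_le : 1 ≤ M 1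
  quot_mono : ∀ k, M (k + 1) / M k ≤ M (k + 2) / M (k + 1)

/-- Moderate growth: `sup_{j, k ≥ 1} (M (j + k) / (M j * M k)) ^ (1 / (j + k)) < ∞`. -/
def HasModerateGrowth (M : ℕ → ℝ) : Prop :=
  ∃ C : ℝ, ∀ j k : ℕ, 1 ≤ j → 1 ≤ k →
    (M (j + k) / (M j * M k)) ^ (1 / ((j : ℝ) + (k : ℝ))) ≤ C

/-- The sequence `m j = (M j) ^ (1 / j)`. For `j = 0` the value is `1`. -/
noncomputable def weightRoot (M : ℕ → ℝ) (j : ℕ) : ℝ :=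
  M j ^ (1 / (j : ℝ))

/-- The length `|α| = α₁ + ⋯ + αₙ` of a multi-index. -/
def multiLength {n : ℕ} (α : Fin n → ℕ) : ℕ :=
  ∑ i, α i

/-- The monomial `x ^ α = x₁ ^ α₁ ⋯ xₙ ^ αₙ`. -/
noncomputable def multiMonomial {n : ℕ} (α : Fin n → ℕ) (x : EuclideanSpace ℝ (Fin n)) : ℝ :=
  ∏ i, x i ^ α i

/-- The first order partial derivative `∂ᵢ f`. -/
noncomputable def partialDeriv {𝕜 : Type*} [RCLike 𝕜] {n : ℕ} (i : Fin n)
    (f : EuclideanSpace ℝ (Fin n) → 𝕜) : EuclideanSpace ℝ (Fin n) → 𝕜 :=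
  fun x => fderiv ℝ f x (EuclideanSpace.single i 1)

/-- The partial derivative `∂ ^ β f = ∂₁ ^ β₁ ⋯ ∂ₙ ^ βₙ f` of multi-index order `β`
(used only for smooth `f`). -/
noncomputable def multiDeriv {𝕜 : Type*} [RCLike 𝕜] {n : ℕ} (β : Fin n → ℕ)
    (f : EuclideanSpace ℝ (Fin n) → 𝕜) : EuclideanSpace ℝ (Fin n) → 𝕜 :=
  (List.finRange n).foldr (fun i g => (partialDeriv i)^[β i] g) f

/-- The finiteness, for given `ρ` and `σ`, of the supremum over all `α`, `β`, `x` of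
`|x ^ α ∂ ^ β f (x)| / ((ρ m_{|α|}) ^ |α| (σ m_{|β|}) ^ |β|)`. -/
def GelfandShilovBound {𝕜 : Type*} [RCLike 𝕜] {n : ℕ} (M : ℕ → ℝ) (ρ σ : ℝ)
    (f : EuclideanSpace ℝ (Fin n) → 𝕜) : Prop :=
  ∃ C : ℝ, ∀ (α β : Fin n → ℕ) (x : EuclideanSpace ℝ (Fin n)),
    |multiMonomial α x| * ‖multiDeriv β f x‖ /
        ((ρ * weightRoot M (multiLength α)) ^ multiLength α *
          (σ * weightRoot M (multiLength β)) ^ multiLength β) ≤ C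

/-- The Gelfand–Shilov class of Roumieu type on `ℝⁿ`, of functions with values in `𝕜`. -/
def gelfandShilovRoumieu (𝕜 : Type*) [RCLike 𝕜] (n : ℕ) (M : ℕ → ℝ) :
    Set (EuclideanSpace ℝ (Fin n) → 𝕜) :=
  {f | ContDiff ℝ ∞ f ∧ ∃ ρ > 0, ∃ σ > 0, GelfandShilovBound M ρ σ f}

/-- The Gelfand–Shilov class of Beurling type on `ℝⁿ`, of functions with values in `𝕜`. -/
def gelfandShilovBeurling (𝕜 : Type*) [RCLike 𝕜] (n : ℕ) (M : ℕ → ℝ) :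
    Set (EuclideanSpace ℝ (Fin n) → 𝕜) :=
  {f | ContDiff ℝ ∞ f ∧ ∀ ρ > 0, ∀ σ > 0, GelfandShilovBound M ρ σ f}

/-- The lacunary estimates with constants `C`, `ρ`, `σ`: for all `j`,
`max_{|α| = k j} sup_x |x ^ α f (x)| ≤ C (ρ m_{k j}) ^ (k j)` and
`max_{|β| = l j} sup_x |∂ ^ β f (x)| ≤ C (σ m_{l j}) ^ (l j)`. -/
def LacunaryBound {𝕜 : Type*} [RCLike 𝕜] {n : ℕ} (M : ℕ → ℝ) (k l : ℕ → ℕ) (C ρ σ : ℝ)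
    (f : EuclideanSpace ℝ (Fin n) → 𝕜) : Prop :=
  ∀ j : ℕ,
    (∀ α : Fin n → ℕ, multiLength α = k j → ∀ x : EuclideanSpace ℝ (Fin n),
      |multiMonomial α x| * ‖f x‖ ≤ C * (ρ * weightRoot M (k j)) ^ k j) ∧
    (∀ β : Fin n → ℕ, multiLength β = l j → ∀ x : EuclideanSpace ℝ (Fin n),
      ‖multiDeriv β f x‖ ≤ C * (σ * weightRoot M (l j)) ^ l j)

/-- The lacunary Gelfand–Shilov class of Roumieu type. -/
def lacunaryGelfandShilovRoumieu (𝕜 : Type*) [RCLike 𝕜] (n : ℕ) (M : ℕ → ℝ) (k l : ℕ → ℕ) :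
    Set (EuclideanSpace ℝ (Fin n) → 𝕜) :=
  {f | ContDiff ℝ ∞ f ∧ ∃ C > 0, ∃ ρ > 0, ∃ σ > 0, LacunaryBound M k l C ρ σ f}

/-- The lacunary Gelfand–Shilov class of Beurling type. -/
def lacunaryGelfandShilovBeurling (𝕜 : Type*) [RCLike 𝕜] (n : ℕ) (M : ℕ → ℝ) (k l : ℕ → ℕ) :
    Set (EuclideanSpace ℝ (Fin n) → 𝕜) :=
  {f | ContDiff ℝ ∞ f ∧ ∀ ρ > 0, ∀ σ > 0, ∃ C > 0, LacunaryBound M k l C ρ σ f}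

/-!
Only the inclusion of the lacunary classes needs work: the lacunary bounds have to control every
mixed expression `x ^ α ∂ ^ β f (x)`. The tool is an interpolation inequality of Landau–Kolmogorov
type with constants that grow only exponentially in the order: if `|g| ≤ ε ≤ C` and
`|g ^ (N)| ≤ C S ^ N` on `[-1, 1]`, then `|g ^ (b) (0)|` is at most
`2 (e ^ 3 max(S, N)) ^ b √(C ε)` whenever `2 b ≤ N` and `1 ≤ N`. To see this, compare `g` with its
Taylor polynomial on an interval so short that the remainder is at most comparable to `ε`, and bound
the coefficients of that polynomial by Cauchy's estimates on a disc, where the Joukowski map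
`w ↦ (w + w⁻¹) / 2` and the maximum principle control its size (the Bernstein–Walsh inequality).

Apply this to `g t = f (x + t v)`, where `N ≥ 2 |β|` is a term of the sequence `l`, and `ε` is the
decay of `f` near `x` provided by a term `Q ≥ 2 |α|` of the sequence `k`. The square root of that
decay still absorbs `x ^ α`, and polarization passes from directional to mixed derivatives. Since
`m_{k_{j+1}} / m_{k_j}` is bounded and moderate growth bounds `m_{2c} / m_c`, the terms `Q` and `N`
can be chosen with `m_Q` and `m_N` comparable to `m_{|α|}` and `m_{|β|}`. The factor `N` in
`max(S, N)` is where the growth of `j / m_j` enters.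
-/

theorem exists_add_inv_div_two_eq (z : ℂ) :
    ∃ w : ℂ, w ≠ 0 ∧ ‖w‖ ≤ 1 ∧ ‖w‖⁻¹ ≤ 1 + 2 * ‖z‖ ∧ (w + w⁻¹) / 2 = z := by
  obtain ⟨s, hs⟩ := IsAlgClosed.exists_pow_nat_eq (z ^ 2 - 1) two_pos
  have hmul : (z + s) * (z - s) = 1 := by linear_combination -hs
  obtain ⟨w, hw1, hw⟩ : ∃ w : ℂ, ‖w‖ ≤ 1 ∧ w * (2 * z - w) = 1 := by
    rcases le_total ‖z + s‖ 1 with h | h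
    · exact ⟨z + s, h, by linear_combination hmul⟩
    · refine ⟨z - s, ?_, by linear_combination hmul⟩
      have hnorm : ‖z + s‖ * ‖z - s‖ = 1 := by rw [← norm_mul, hmul, norm_one]
      exact hnorm ▸ le_mul_of_one_le_left (norm_nonneg _) h
  have hinv : w⁻¹ = 2 * z - w := (eq_inv_of_mul_eq_one_right hw).symm
  refine ⟨w, left_ne_zero_of_mul_eq_one hw, hw1, ?_, by rw [hinv]; ring⟩
  calc ‖w‖⁻¹ = ‖2 * z - w‖ := by rw [← norm_inv, hinv]
    _ ≤ ‖2 * z‖ + ‖w‖ := norm_sub_le _ _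
    _ ≤ 1 + 2 * ‖z‖ := by
      rw [norm_mul, Complex.norm_ofNat]
      linarith

/-- The polynomial function of `w` which, for `p` of degree at most `N`, extends
`w ^ N * p ((w + w⁻¹) / 2)` to `w = 0`. -/
noncomputable def joukowskiPullback (N : ℕ) (p : Polynomial ℂ) (w : ℂ) : ℂ :=
  ∑ i ∈ Finset.range (N + 1), p.coeff i * ((w ^ 2 + 1) / 2) ^ i * w ^ (N - i)

theorem joukowskiPullback_eq {N : ℕ} {p : Polynomial ℂ} (hp : p.natDegree ≤ N) {w : ℂ}
    (hw : w ≠ 0) : joukowskiPullback N p w = w ^ N * p.eval ((w + w⁻¹) / 2) := by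
  rw [joukowskiPullback, Polynomial.eval_eq_sum_range' (Nat.lt_succ_of_le hp), Finset.mul_sum]
  refine Finset.sum_congr rfl fun i hi => ?_
  have hsplit : w ^ N = w ^ (N - i) * w ^ i := by
    rw [← pow_add, Nat.sub_add_cancel (Nat.lt_succ_iff.mp (Finset.mem_range.mp hi))]
  have hquad : (w ^ 2 + 1) / 2 = w * ((w + w⁻¹) / 2) := by field_simp
  rw [hsplit, hquad, mul_pow]
  ring

theorem norm_joukowskiPullback_le {N : ℕ} {p : Polynomial ℂ} (hp : p.natDegree ≤ N) {B : ℝ}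
    (hB : ∀ t ∈ Icc (-1 : ℝ) 1, ‖p.eval (t : ℂ)‖ ≤ B) {w : ℂ} (hw : ‖w‖ ≤ 1) :
    ‖joukowskiPullback N p w‖ ≤ B := by
  have hdiff : Differentiable ℂ (joukowskiPullback N p) := by
    unfold joukowskiPullback
    fun_prop
  refine Complex.norm_le_of_forall_mem_frontier_norm_le (U := Metric.ball (0 : ℂ) 1)
    Metric.isBounded_ball hdiff.diffContOnCl (fun u hu => ?_) ?_
  · rw [frontier_ball _ one_ne_zero, mem_sphere_zero_iff_norm] at hu
    have hre : (u + u⁻¹) / 2 = (u.re : ℂ) := by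
      rw [Complex.inv_eq_conj hu, Complex.re_eq_add_conj]
    have hu0 : u ≠ 0 := norm_ne_zero_iff.mp (hu ▸ one_ne_zero)
    rw [joukowskiPullback_eq hp hu0, norm_mul, norm_pow, hu, one_pow, one_mul, hre]
    exact hB _ (abs_le.mp (hu ▸ Complex.abs_re_le_norm u))
  · rwa [closure_ball _ one_ne_zero, mem_closedBall_zero_iff]

theorem norm_eval_le_of_norm_eval_le_on_Icc {N : ℕ} {p : Polynomial ℂ} (hp : p.natDegree ≤ N)
    {B : ℝ} (hB : ∀ t ∈ Icc (-1 : ℝ) 1, ‖p.eval (t : ℂ)‖ ≤ B) (z : ℂ) :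
    ‖p.eval z‖ ≤ (1 + 2 * ‖z‖) ^ N * B := by
  obtain ⟨w, hw0, hw1, hinv, rfl⟩ := exists_add_inv_div_two_eq z
  set z := (w + w⁻¹) / 2
  calc ‖p.eval z‖ = ‖w‖⁻¹ ^ N * ‖joukowskiPullback N p w‖ := by
        rw [joukowskiPullback_eq hp hw0, norm_mul, norm_pow, ← mul_assoc, ← mul_pow,
          inv_mul_cancel₀ (norm_ne_zero_iff.mpr hw0), one_pow, one_mul]
    _ ≤ (1 + 2 * ‖z‖) ^ N * B := by
        gcongr
        exact norm_joukowskiPullback_le hp hB hw1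

theorem iteratedDeriv_polynomial_eval (p : Polynomial ℂ) (s : ℕ) :
    iteratedDeriv s (fun z => p.eval z) = fun z => (Polynomial.derivative^[s] p).eval z := by
  induction s with
  | zero => simp
  | succ s ih =>
    funext z
    rw [iteratedDeriv_succ, ih, Polynomial.deriv, Function.iterate_succ_apply']

theorem one_add_two_mul_div_pow_le_exp (s N : ℕ) :
    (1 + 2 * (s / N : ℝ)) ^ N ≤ Real.exp 2 ^ s := by
  rcases eq_or_ne N 0 with rfl | hN
  · simpa using one_le_pow₀ (Real.one_le_exp zero_le_two)
  · calc (1 + 2 * (s / N : ℝ)) ^ N ≤ Real.exp (2 * (s / N)) ^ N := by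
          gcongr
          linarith [Real.add_one_le_exp (2 * (s / N : ℝ))]
      _ = Real.exp 2 ^ s := by
          rw [← Real.exp_nat_mul, ← Real.exp_nat_mul]
          field_simp

theorem factorial_mul_norm_coeff_le {N : ℕ} {p : Polynomial ℂ} (hp : p.natDegree ≤ N) {B : ℝ}
    (hB : ∀ t ∈ Icc (-1 : ℝ) 1, ‖p.eval (t : ℂ)‖ ≤ B) (s : ℕ) :
    (s.factorial : ℝ) * ‖p.coeff s‖ ≤ (Real.exp 2 * N) ^ s * B := by
  have hB0 : 0 ≤ B := (norm_nonneg _).trans (hB 0 (by norm_num))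
  rcases lt_or_ge N s with hs | hs
  · rw [Polynomial.coeff_eq_zero_of_natDegree_lt (hp.trans_lt hs), norm_zero, mul_zero]
    positivity
  rcases Nat.eq_zero_or_pos s with rfl | hs0
  · simpa [Polynomial.coeff_zero_eq_eval_zero] using hB 0 (by norm_num)
  have hN0 : 0 < N := hs0.trans_le hs
  have hderiv : iteratedDeriv s (fun z => p.eval z) 0 = (s.factorial : ℂ) * p.coeff s := by
    rw [iteratedDeriv_polynomial_eval]
    simp [← Polynomial.coeff_zero_eq_eval_zero, Polynomial.coeff_iterate_derivative,
      Nat.descFactorial_self]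
  -- The radius `s / N` balances the growth `(1 + 2 r) ^ N` against the Cauchy factor `r ^ (-s)`.
  have hcauchy := Complex.norm_iteratedDeriv_le_of_forall_mem_sphere_norm_le (c := 0) s
    (R := s / N) (by positivity) (f := fun z => p.eval z) p.differentiable.diffContOnCl
    (C := Real.exp 2 ^ s * B) fun z hz => by
      rw [mem_sphere_zero_iff_norm] at hz
      refine (norm_eval_le_of_norm_eval_le_on_Icc hp hB z).trans ?_
      rw [hz]
      gcongr
      exact one_add_two_mul_div_pow_le_exp s N
  rw [hderiv, norm_mul, Complex.norm_natCast] at hcauchy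
  have hfac : (s.factorial : ℝ) ≤ (s : ℝ) ^ s := by exact_mod_cast Nat.factorial_le_pow s
  calc (s.factorial : ℝ) * ‖p.coeff s‖
      ≤ s.factorial * (Real.exp 2 ^ s * B) / (s / N) ^ s := hcauchy
    _ ≤ (s : ℝ) ^ s * (Real.exp 2 ^ s * B) / (s / N) ^ s := by gcongr
    _ = (Real.exp 2 * N) ^ s * B := by
        rw [div_pow, mul_pow]
        field_simp

theorem factorial_mul_abs_le_of_abs_sum_le {N s : ℕ} (hs : s < N) {c : ℕ → ℝ} {L B : ℝ}
    (hL : 0 < L) (hB : ∀ x, |x| ≤ L → |∑ i ∈ Finset.range N, c i * x ^ i| ≤ B) :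
    s.factorial * |c s| ≤ (Real.exp 2 * N / L) ^ s * B := by
  set p : Polynomial ℂ := ∑ i ∈ Finset.range N, Polynomial.monomial i ((c i * L ^ i : ℝ) : ℂ)
    with hp
  have hdeg : p.natDegree ≤ N := Polynomial.natDegree_sum_le_of_forall_le _ _ fun i hi =>
    (Polynomial.natDegree_monomial_le _).trans (Finset.mem_range.mp hi).le
  have hcoeff : p.coeff s = ((c s * L ^ s : ℝ) : ℂ) := by
    simp [hp, Polynomial.finsetSum_coeff, Polynomial.coeff_monomial, hs]
  have heval (t : ℝ) : p.eval (t : ℂ) = ((∑ i ∈ Finset.range N, c i * (L * t) ^ i : ℝ) : ℂ) := by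
    simp [hp, Polynomial.eval_finsetSum, mul_pow, mul_assoc]
  have hmain := factorial_mul_norm_coeff_le hdeg (B := B) (fun t ht => by
    rw [heval, Complex.norm_real, Real.norm_eq_abs]
    refine hB _ ?_
    rw [abs_mul, abs_of_pos hL]
    exact mul_le_of_le_one_right hL.le (abs_le.mpr ht)) s
  rw [hcoeff, Complex.norm_real, Real.norm_eq_abs, abs_mul, abs_of_pos (pow_pos hL s),
    ← mul_assoc] at hmain
  rwa [div_pow, div_mul_eq_mul_div, le_div_iff₀ (by positivity)]

theorem abs_sum_iteratedDeriv_le {g : ℝ → ℝ} {N : ℕ} (hg : ContDiff ℝ (N + 1) g)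
    {L ε K : ℝ} (hε : ∀ t, |t| ≤ L → |g t| ≤ ε)
    (hK : ∀ t, |t| ≤ L → |iteratedDeriv (N + 1) g t| ≤ K) {x : ℝ} (hx : |x| ≤ L) :
    |∑ i ∈ Finset.range (N + 1), iteratedDeriv i g 0 / i.factorial * x ^ i| ≤
      ε + L ^ (N + 1) / (N + 1).factorial * K := by
  have hL0 : 0 ≤ L := (abs_nonneg x).trans hx
  have hK0 : 0 ≤ K := (abs_nonneg _).trans (hK x hx)
  rcases eq_or_ne x 0 with rfl | hx0
  · rw [Finset.sum_range_succ', Finset.sum_eq_zero (by simp)]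
    simpa using (hε 0 hx).trans (le_add_of_nonneg_right (by positivity))
  obtain ⟨y, hy, hxy⟩ := taylor_mean_remainder_lagrange_iteratedDeriv hx0.symm hg.contDiffOn
  have htaylor : taylorWithinEval g N (uIcc 0 x) 0 x =
      ∑ i ∈ Finset.range (N + 1), iteratedDeriv i g 0 / i.factorial * x ^ i := by
    rw [taylor_within_apply]
    refine Finset.sum_congr rfl fun i hi => ?_
    have hiN : (i : WithTop ℕ∞) ≤ N + 1 := by exact_mod_cast (Finset.mem_range.mp hi).le
    rw [sub_zero, smul_eq_mul, iteratedDerivWithin_eq_iteratedDeriv (uniqueDiffOn_uIcc hx0.symm)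
      (hg.of_le hiN).contDiffAt left_mem_uIcc]
    ring
  have hyL : |y| ≤ L := by
    simpa using (abs_sub_left_of_mem_uIcc (uIoo_subset_uIcc_self hy)).trans (by simpa using hx)
  rw [htaylor, sub_zero] at hxy
  rw [← sub_sub_cancel (g x) (∑ i ∈ Finset.range (N + 1), _), hxy]
  refine (abs_sub _ _).trans (add_le_add (hε x hx) ?_)
  rw [abs_div, abs_mul, abs_pow, Nat.abs_cast, mul_comm, div_mul_eq_mul_div]
  gcongr
  exact hK y hyL

theorem abs_iteratedDeriv_zero_le {g : ℝ → ℝ} {N s : ℕ} (hg : ContDiff ℝ N g) (hs : s < N)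
    {L ε K : ℝ} (hL : 0 < L) (hε : ∀ t, |t| ≤ L → |g t| ≤ ε)
    (hK : ∀ t, |t| ≤ L → |iteratedDeriv N g t| ≤ K) :
    |iteratedDeriv s g 0| ≤ (Real.exp 2 * N / L) ^ s * (ε + L ^ N / N.factorial * K) := by
  obtain ⟨N, rfl⟩ := Nat.exists_eq_add_one_of_ne_zero (Nat.ne_zero_of_lt hs)
  have h := factorial_mul_abs_le_of_abs_sum_le hs hL fun x hx =>
    abs_sum_iteratedDeriv_le (by exact_mod_cast hg) hε hK hx
  rwa [abs_div, Nat.abs_cast, mul_div_cancel₀ _ (by positivity)] at h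

section NormedSpace

variable {F : Type*} [NormedAddCommGroup F] [NormedSpace ℝ F]

theorem norm_iteratedDeriv_zero_le {g : ℝ → F} {N s : ℕ} (hg : ContDiff ℝ N g) (hs : s < N)
    {L ε K : ℝ} (hL : 0 < L) (hε : ∀ t, |t| ≤ L → ‖g t‖ ≤ ε)
    (hK : ∀ t, |t| ≤ L → ‖iteratedDeriv N g t‖ ≤ K) :
    ‖iteratedDeriv s g 0‖ ≤ (Real.exp 2 * N / L) ^ s * (ε + L ^ N / N.factorial * K) := by
  obtain ⟨φ, hφ1, hφ⟩ := exists_dual_vector'' ℝ (iteratedDeriv s g 0)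
  have hcomp {i : ℕ} (hi : i ≤ N) (t : ℝ) :
      iteratedDeriv i (φ ∘ g) t = φ (iteratedDeriv i g t) := by
    rw [iteratedDeriv_eq_iteratedFDeriv, iteratedDeriv_eq_iteratedFDeriv,
      φ.iteratedFDeriv_comp_left hg.contDiffAt (by exact_mod_cast hi)]
    rfl
  have hle (v : F) : |φ v| ≤ ‖v‖ := φ.le_of_opNorm_le_of_le hφ1 le_rfl |>.trans_eq (one_mul _)
  have h := abs_iteratedDeriv_zero_le (φ.contDiff.comp hg) hs hL
    (fun t ht => (hle _).trans (hε t ht))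
    (fun t ht => (hcomp le_rfl t).symm ▸ (hle _).trans (hK t ht))
  rw [hcomp hs.le, hφ] at h
  simpa using h

theorem pow_div_factorial_le_exp_one_pow (N : ℕ) :
    (N : ℝ) ^ N / N.factorial ≤ Real.exp 1 ^ N := by
  rw [← Real.exp_nat_mul, mul_one]
  exact Real.pow_div_factorial_le_exp _ N.cast_nonneg N

theorem div_pow_div_factorial_mul_pow_le_one {N : ℕ} {U T : ℝ} (hU : 0 ≤ U)
    (hUT : Real.exp 1 * U ≤ T) : (N / T) ^ N / N.factorial * U ^ N ≤ 1 := by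
  have hT : 0 ≤ T := (by positivity : 0 ≤ Real.exp 1 * U).trans hUT
  calc (N / T) ^ N / N.factorial * U ^ N = (N : ℝ) ^ N / N.factorial * (U / T) ^ N := by
        rw [div_pow, div_pow]
        ring
    _ ≤ Real.exp 1 ^ N * (U / T) ^ N := by
        gcongr
        exact pow_div_factorial_le_exp_one_pow N
    _ = (Real.exp 1 * U / T) ^ N := by rw [← mul_pow, mul_div_assoc]
    _ ≤ 1 := pow_le_one₀ (by positivity) (div_le_one_of_le₀ hUT hT)

theorem norm_iteratedDeriv_zero_le_two_mul {g : ℝ → F} {N s : ℕ} (hg : ContDiff ℝ N g)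
    (hs : s < N) {ε U : ℝ} (hU : 0 ≤ U) (hε : ∀ t, |t| ≤ 1 → ‖g t‖ ≤ ε)
    (hK : ∀ t, |t| ≤ 1 → ‖iteratedDeriv N g t‖ ≤ ε * U ^ N) :
    ‖iteratedDeriv s g 0‖ ≤ 2 * ε * (Real.exp 2 * max (Real.exp 1 * U) N) ^ s := by
  have hN : (0 : ℝ) < N := by exact_mod_cast hs.pos
  have hε0 : 0 ≤ ε := (norm_nonneg _).trans (hε 0 (by norm_num))
  -- The interval `[-L, L]` with `L = N / T` makes the Taylor remainder at most `ε`.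
  set T : ℝ := max (Real.exp 1 * U) N
  have hT : 0 < T := lt_max_of_lt_right hN
  have hL : N / T ≤ 1 := (div_le_one hT).mpr (le_max_right _ _)
  have hrem : (N / T) ^ N / N.factorial * (ε * U ^ N) ≤ ε := by
    rw [mul_left_comm]
    exact mul_le_of_le_one_right hε0
      (div_pow_div_factorial_mul_pow_le_one hU (le_max_left _ _))
  calc ‖iteratedDeriv s g 0‖
      ≤ (Real.exp 2 * N / (N / T)) ^ s * (ε + (N / T) ^ N / N.factorial * (ε * U ^ N)) :=
        norm_iteratedDeriv_zero_le hg hs (div_pos hN hT)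
          (fun t ht => hε t (ht.trans hL)) fun t ht => hK t (ht.trans hL)
    _ ≤ (Real.exp 2 * N / (N / T)) ^ s * (ε + ε) := by gcongr
    _ = 2 * ε * (Real.exp 2 * T) ^ s := by
        rw [show Real.exp 2 * N / (N / T) = Real.exp 2 * T by field_simp]
        ring

theorem norm_iteratedDeriv_zero_le_sqrt {g : ℝ → F} {N b : ℕ} (hg : ContDiff ℝ N g)
    (hN : 1 ≤ N) (hb : 2 * b ≤ N) {ε C S : ℝ} (hε0 : 0 < ε) (hεC : ε ≤ C) (hS : 0 ≤ S)
    (hε : ∀ t, |t| ≤ 1 → ‖g t‖ ≤ ε) (hK : ∀ t, |t| ≤ 1 → ‖iteratedDeriv N g t‖ ≤ C * S ^ N) :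
    ‖iteratedDeriv b g 0‖ ≤ 2 * (Real.exp 3 * max S N) ^ b * √(C * ε) := by
  obtain ⟨q, hq1, hqN⟩ : ∃ q : ℝ, 1 ≤ q ∧ q ^ N = C / ε :=
    ⟨(C / ε) ^ (N : ℝ)⁻¹, Real.one_le_rpow ((one_le_div hε0).mpr hεC) (by positivity),
      Real.rpow_inv_natCast_pow (div_nonneg (hε0.le.trans hεC) hε0.le) (by lia)⟩
  have hmax : max (Real.exp 1 * (q * S)) N ≤ q * (Real.exp 1 * max S N) := by
    refine max_le ?_ ?_
    · rw [mul_left_comm]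
      gcongr
      exact le_max_left _ _
    · have he1 : 1 ≤ Real.exp 1 := Real.one_le_exp zero_le_one
      exact (le_max_right S N).trans ((le_mul_of_one_le_left (by positivity) he1).trans
        (le_mul_of_one_le_left (by positivity) hq1))
  have hqb : q ^ b * ε ≤ √(C * ε) := Real.le_sqrt_of_sq_le <| by
    calc (q ^ b * ε) ^ 2 = q ^ (2 * b) * ε ^ 2 := by ring
      _ ≤ q ^ N * ε ^ 2 := by gcongr
      _ = C * ε := by
        rw [hqN]
        field_simp
  calc ‖iteratedDeriv b g 0‖
      ≤ 2 * ε * (Real.exp 2 * max (Real.exp 1 * (q * S)) N) ^ b :=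
        norm_iteratedDeriv_zero_le_two_mul hg (by lia) (by positivity) hε fun t ht =>
          (hK t ht).trans_eq <| by
            rw [mul_pow, hqN]
            field_simp
    _ ≤ 2 * ε * (Real.exp 2 * (q * (Real.exp 1 * max S N))) ^ b := by gcongr
    _ = 2 * (Real.exp 3 * max S N) ^ b * (q ^ b * ε) := by
      rw [show (3 : ℝ) = 2 + 1 by norm_num, Real.exp_add]
      simp only [mul_pow]
      ring
    _ ≤ 2 * (Real.exp 3 * max S N) ^ b * √(C * ε) := by gcongr

theorem iteratedDeriv_comp_line {E : Type*} [NormedAddCommGroup E] [NormedSpace ℝ E] {f : E → F}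
    {N : ℕ} (hf : ContDiff ℝ N f) (x v : E) :
    iteratedDeriv N (fun t : ℝ => f (x + t • v)) =
      fun t => iteratedFDeriv ℝ N f (x + t • v) (fun _ => v) := by
  induction N with
  | zero => simp
  | succ N ih =>
    funext t
    have hdiff : Differentiable ℝ (iteratedFDeriv ℝ N f) :=
      hf.differentiable_iteratedFDeriv (by exact_mod_cast N.lt_succ_self)
    have hline : HasDerivAt (fun t : ℝ => x + t • v) v t := by
      simpa using ((hasDerivAt_id t).smul_const v).const_add x
    have happly : DifferentiableAt ℝ (fun y => iteratedFDeriv ℝ N f y (fun _ => v)) (x + t • v) :=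
      (ContinuousMultilinearMap.apply ℝ (fun _ : Fin N => E) F fun _ => v).differentiableAt.comp
        (x + t • v) (hdiff _)
    rw [iteratedDeriv_succ, ih (hf.of_le (by exact_mod_cast N.le_succ)),
      (hdiff _).iteratedFDeriv_succ_apply_left']
    exact (happly.hasFDerivAt.comp_hasDerivAt t hline).deriv

end NormedSpace

section Polarization

variable {ι : Type*} [Fintype ι]

theorem sum_neg_one_pow_card_of_forall_mem {R κ : Type*} [CommRing R] [DecidableEq ι]
    [Fintype κ] (r : κ → ι) :
    ∑ S : Finset ι with ∀ j, r j ∈ S, (-1 : R) ^ S.card =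
      if Function.Surjective r then (-1) ^ Fintype.card ι else 0 := by
  have hprod (S : Finset ι) : (∏ i ∈ Finset.univ \ S, if ∀ j, r j ≠ i then (1 : R) else 0) =
      if ∀ j, r j ∈ S then 1 else 0 := by
    have hmem : (∀ i ∈ Finset.univ \ S, ∀ j, r j ≠ i) ↔ ∀ j, r j ∈ S := by
      refine ⟨fun h j => by_contra fun hj => h (r j) (by simpa using hj) j rfl,
        fun h i hi j hij => ?_⟩
      exact (Finset.mem_sdiff.mp hi).2 (hij ▸ h j)
    simp only [Finset.prod_boole, hmem]
  calc ∑ S : Finset ι with ∀ j, r j ∈ S, (-1 : R) ^ S.card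
      = ∏ i : ι, ((if ∀ j, r j ≠ i then 1 else 0) - 1 : R) := by
        rw [Finset.prod_sub, Finset.powerset_univ, Finset.sum_filter]
        simp only [hprod, Finset.prod_const_one, mul_one, mul_ite, mul_zero]
    _ = if Function.Surjective r then (-1) ^ Fintype.card ι else 0 := by
        split_ifs with hr
        · have hne (i : ι) : ¬∀ j, r j ≠ i := not_forall_not.mpr (hr i)
          simp [if_neg (hne _)]
        · obtain ⟨i, hi⟩ := not_forall.mp hr
          refine Finset.prod_eq_zero (Finset.mem_univ i) ?_
          rw [if_pos (not_exists.mp hi), sub_self]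

theorem polarization [DecidableEq ι] {R E F : Type*} [CommRing R] [AddCommGroup E] [Module R E]
    [AddCommGroup F] [Module R F] (T : MultilinearMap R (fun _ : ι => E) F) (v : ι → E) :
    ∑ S : Finset ι, (-1 : R) ^ S.card • T (fun _ => ∑ i ∈ S, v i) =
      (-1 : R) ^ Fintype.card ι • ∑ σ : Equiv.Perm ι, T (v ∘ σ) := by
  have hexpand (S : Finset ι) : T (fun _ => ∑ i ∈ S, v i) =
      ∑ r : ι → ι with ∀ i, r i ∈ S, T (v ∘ r) := by
    rw [T.map_sum_finset (fun _ i => v i) fun _ => S]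
    refine Finset.sum_congr ?_ fun _ _ => rfl
    ext r
    simp [Fintype.mem_piFinset]
  calc ∑ S : Finset ι, (-1 : R) ^ S.card • T (fun _ => ∑ i ∈ S, v i)
      = ∑ r : ι → ι, (∑ S : Finset ι with ∀ i, r i ∈ S, (-1 : R) ^ S.card) • T (v ∘ r) := by
        simp only [hexpand, Finset.smul_sum, Finset.sum_smul]
        exact Finset.sum_comm' (by simp)
    _ = ∑ r : ι → ι with Function.Surjective r, (-1 : R) ^ Fintype.card ι • T (v ∘ r) := by
        simp only [sum_neg_one_pow_card_of_forall_mem, ite_smul, zero_smul]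
        rw [Finset.sum_filter]
    _ = (-1 : R) ^ Fintype.card ι • ∑ σ : Equiv.Perm ι, T (v ∘ σ) := by
        rw [Finset.smul_sum]
        symm
        refine Finset.sum_bij (fun (σ : Equiv.Perm ι) _ => (σ : ι → ι)) ?_ ?_ ?_ fun _ _ => rfl
        · exact fun σ _ => by simpa using σ.surjective
        · exact fun σ _ τ _ h => DFunLike.coe_injective h
        · intro r hr
          have hr : Function.Surjective r := (Finset.mem_filter.mp hr).2
          exact ⟨Equiv.ofBijective r ⟨Finite.injective_iff_surjective.mpr hr, hr⟩,
            Finset.mem_univ _, rfl⟩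

theorem norm_le_of_forall_norm_diagonal_le {E F : Type*} [AddCommGroup E] [Module ℝ E]
    [NormedAddCommGroup F] [NormedSpace ℝ F] {T : MultilinearMap ℝ (fun _ : ι => E) F}
    {v : ι → E} (hT : ∀ σ : Equiv.Perm ι, T (v ∘ σ) = T v) {s : Set E} (hs : Convex ℝ s)
    (h0 : 0 ∈ s) (hv : ∀ i, v i ∈ s) {K : ℝ} (hK : ∀ w ∈ s, ‖T fun _ => w‖ ≤ K) :
    ‖T v‖ ≤ (2 * Real.exp 1) ^ Fintype.card ι * K := by
  classical
  set b := Fintype.card ι with hb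
  have hK0 : 0 ≤ K := (norm_nonneg _).trans (hK 0 h0)
  have hdiag (S : Finset ι) : ‖T fun _ => ∑ i ∈ S, v i‖ ≤ (b : ℝ) ^ b * K := by
    rcases isEmpty_or_nonempty ι with hι | hι
    · simpa [hb, Finset.eq_empty_of_isEmpty S] using hK 0 h0
    have hb0 : (b : ℝ) ≠ 0 := by exact_mod_cast Fintype.card_ne_zero
    have hmem : (b : ℝ)⁻¹ • ∑ i ∈ S, v i ∈ s := by
      have := hs.sum_mem (t := Finset.univ) (w := fun _ : ι => (b : ℝ)⁻¹)
        (z := fun i => if i ∈ S then v i else 0) (fun _ _ => by positivity) (by simp [hb])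
        (fun i _ => by split_ifs <;> simp [h0, hv])
      simpa [← Finset.smul_sum] using this
    rw [← smul_inv_smul₀ hb0 (∑ i ∈ S, v i), T.map_smul_univ (fun _ => (b : ℝ)), norm_smul]
    simp only [Finset.prod_const, Finset.card_univ, norm_pow, Real.norm_natCast, ← hb]
    gcongr
    exact hK _ hmem
  have hpol : (b.factorial : ℝ) * ‖T v‖ ≤ 2 ^ b * ((b : ℝ) ^ b * K) := by
    calc (b.factorial : ℝ) * ‖T v‖
        = ‖∑ S : Finset ι, (-1 : ℝ) ^ S.card • T (fun _ => ∑ i ∈ S, v i)‖ := by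
          simp [polarization, hT, norm_smul, Fintype.card_perm, ← Nat.cast_smul_eq_nsmul ℝ, hb]
      _ ≤ ∑ _S : Finset ι, (b : ℝ) ^ b * K :=
          norm_sum_le_of_le _ fun S _ => by simpa [norm_smul] using hdiag S
      _ = 2 ^ b * ((b : ℝ) ^ b * K) := by simp [hb]
  calc ‖T v‖ ≤ 2 ^ b * ((b : ℝ) ^ b * K) / b.factorial := by
        rwa [le_div_iff₀' (by positivity)]
    _ = 2 ^ b * ((b : ℝ) ^ b / b.factorial) * K := by ring
    _ ≤ 2 ^ b * Real.exp 1 ^ b * K := by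
        gcongr
        exact pow_div_factorial_le_exp_one_pow b
    _ = (2 * Real.exp 1) ^ b * K := by rw [mul_pow]

end Polarization

section PartialDerivatives

variable {𝕜 : Type*} [RCLike 𝕜] {n : ℕ} {f : EuclideanSpace ℝ (Fin n) → 𝕜}

theorem contDiff_partialDeriv (hf : ContDiff ℝ ∞ f) (i : Fin n) :
    ContDiff ℝ ∞ (partialDeriv i f) :=
  (hf.fderiv_right (m := ∞) (by simp)).clm_apply contDiff_const

theorem contDiff_foldr_partialDeriv (hf : ContDiff ℝ ∞ f) (L : List (Fin n)) :
    ContDiff ℝ ∞ (L.foldr partialDeriv f) := by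
  induction L with
  | nil => exact hf
  | cons i L ih => exact contDiff_partialDeriv ih i

theorem partialDeriv_comm (hf : ContDiff ℝ 2 f) (i j : Fin n) :
    partialDeriv i (partialDeriv j f) = partialDeriv j (partialDeriv i f) := by
  have hdiff : Differentiable ℝ (fderiv ℝ f) :=
    (hf.fderiv_right (m := 1) (by norm_num)).differentiable one_ne_zero
  have happly (i j : Fin n) (x : EuclideanSpace ℝ (Fin n)) : partialDeriv i (partialDeriv j f) x =
      fderiv ℝ (fderiv ℝ f) x (EuclideanSpace.single i 1) (EuclideanSpace.single j 1) := by
    unfold partialDeriv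
    rw [fderiv_clm_apply (hdiff x) (differentiableAt_const _)]
    simp
  funext x
  rw [happly, happly]
  exact (hf.contDiffAt.isSymmSndFDerivAt (by simp)).eq _ _

theorem foldr_partialDeriv_eq_of_perm (hf : ContDiff ℝ ∞ f) {L L' : List (Fin n)}
    (h : L.Perm L') : L.foldr partialDeriv f = L'.foldr partialDeriv f := by
  induction h with
  | nil => rfl
  | cons i _ ih => rw [List.foldr_cons, ih, List.foldr_cons]
  | swap i j L =>
    exact partialDeriv_comm (contDiff_infty.mp (contDiff_foldr_partialDeriv hf L) 2) j i
  | trans _ _ h₁ h₂ => exact h₁.trans h₂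

/-- The list of coordinate directions, in increasing order, in which the multi-index `β`
differentiates: the index `i` occurs `β i` times. -/
def multiIndexList (β : Fin n → ℕ) : List (Fin n) :=
  (List.finRange n).flatMap fun i => List.replicate (β i) i

theorem multiDeriv_eq_foldr (β : Fin n → ℕ) (f : EuclideanSpace ℝ (Fin n) → 𝕜) :
    multiDeriv β f = (multiIndexList β).foldr partialDeriv f := by
  have hiterate (i : Fin n) (m : ℕ) (g : EuclideanSpace ℝ (Fin n) → 𝕜) :
      (partialDeriv i)^[m] g = (List.replicate m i).foldr partialDeriv g := by
    induction m with
    | zero => rfl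
    | succ m ih => rw [Function.iterate_succ_apply', ih, List.replicate_succ, List.foldr_cons]
  unfold multiDeriv multiIndexList
  induction List.finRange n with
  | nil => rfl
  | cons i L ih => rw [List.foldr_cons, ih, List.flatMap_cons, List.foldr_append, hiterate]

theorem length_multiIndexList (β : Fin n → ℕ) : (multiIndexList β).length = multiLength β := by
  simp [multiIndexList, multiLength, List.length_flatMap, Fin.sum_univ_def]

theorem count_multiIndexList (β : Fin n → ℕ) (i : Fin n) : (multiIndexList β).count i = β i := by
  simp [multiIndexList, List.count_flatMap, Function.comp_def, List.count_replicate,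
    ← Fin.sum_univ_def]

theorem perm_multiIndexList_count (L : List (Fin n)) :
    L.Perm (multiIndexList fun i => L.count i) :=
  List.perm_iff_count.mpr fun i => by rw [count_multiIndexList]

theorem foldr_partialDeriv_eq_multiDeriv (hf : ContDiff ℝ ∞ f) (L : List (Fin n)) :
    L.foldr partialDeriv f = multiDeriv (fun i => L.count i) f := by
  rw [multiDeriv_eq_foldr, foldr_partialDeriv_eq_of_perm hf (perm_multiIndexList_count L)]

theorem multiLength_count (L : List (Fin n)) : multiLength (fun i => L.count i) = L.length := by
  rw [← length_multiIndexList, (perm_multiIndexList_count L).length_eq]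

theorem iteratedFDeriv_single_eq_foldr (hf : ContDiff ℝ ∞ f) {N : ℕ} (r : Fin N → Fin n)
    (x : EuclideanSpace ℝ (Fin n)) :
    iteratedFDeriv ℝ N f x (fun j => EuclideanSpace.single (r j) 1) =
      (List.ofFn r).foldr partialDeriv f x := by
  induction N generalizing x with
  | zero => simp
  | succ N ih =>
    have hdiff : DifferentiableAt ℝ (iteratedFDeriv ℝ N f) x :=
      hf.differentiable_iteratedFDeriv (by exact_mod_cast WithTop.coe_lt_top _) x
    rw [hdiff.iteratedFDeriv_succ_apply_left', List.ofFn_succ, List.foldr_cons, partialDeriv]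
    congr 2
    funext y
    exact ih (fun j => r j.succ) y

theorem norm_iteratedFDeriv_diagonal_le (hf : ContDiff ℝ ∞ f) {N : ℕ} {K : ℝ} (hK0 : 0 ≤ K)
    {x : EuclideanSpace ℝ (Fin n)}
    (hK : ∀ β : Fin n → ℕ, multiLength β = N → ‖multiDeriv β f x‖ ≤ K)
    {v : EuclideanSpace ℝ (Fin n)} (hv : ∑ i, |v i| ≤ 1) :
    ‖iteratedFDeriv ℝ N f x (fun _ => v)‖ ≤ K := by
  have hbasis : v = ∑ i, v i • EuclideanSpace.single i (1 : ℝ) := by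
    ext j
    simp [Finset.sum_apply, Pi.single_apply]
  have hexpand : iteratedFDeriv ℝ N f x (fun _ => v) = ∑ r : Fin N → Fin n,
      (∏ j, v (r j)) • iteratedFDeriv ℝ N f x (fun j => EuclideanSpace.single (r j) 1) := by
    conv_lhs => rw [hbasis]
    rw [ContinuousMultilinearMap.map_sum]
    exact Finset.sum_congr rfl fun r _ => ContinuousMultilinearMap.map_smul_univ _ _ _
  calc ‖iteratedFDeriv ℝ N f x (fun _ => v)‖
      ≤ ∑ r : Fin N → Fin n, (∏ j, |v (r j)|) * K := by
        rw [hexpand]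
        refine norm_sum_le_of_le _ fun r _ => ?_
        rw [norm_smul, Real.norm_eq_abs, Finset.abs_prod, iteratedFDeriv_single_eq_foldr hf,
          foldr_partialDeriv_eq_multiDeriv hf]
        gcongr
        exact hK _ (by rw [multiLength_count, List.length_ofFn])
    _ = (∑ i, |v i|) ^ N * K := by
        rw [← Finset.sum_mul, Fintype.sum_pow]
    _ ≤ K := mul_le_of_le_one_left hK0
        (pow_le_one₀ (Finset.sum_nonneg fun _ _ => abs_nonneg _) hv)

theorem convex_setOf_sum_abs_le_one :
    Convex ℝ {v : EuclideanSpace ℝ (Fin n) | ∑ i, |v i| ≤ 1} := by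
  intro v hv w hw a b ha hb hab
  calc ∑ i, |(a • v + b • w) i| ≤ ∑ i, (a * |v i| + b * |w i|) := by
        refine Finset.sum_le_sum fun i _ => (abs_add_le _ _).trans_eq ?_
        simp [abs_mul, abs_of_nonneg ha, abs_of_nonneg hb]
    _ = a * ∑ i, |v i| + b * ∑ i, |w i| := by
        rw [Finset.sum_add_distrib, ← Finset.mul_sum, ← Finset.mul_sum]
    _ ≤ a * 1 + b * 1 := by
        gcongr
        exacts [hv, hw]
    _ = 1 := by rw [mul_one, mul_one, hab]

theorem norm_multiDeriv_le_of_diagonal (hf : ContDiff ℝ ∞ f) {K : ℝ}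
    {x : EuclideanSpace ℝ (Fin n)} {β : Fin n → ℕ}
    (hK : ∀ v : EuclideanSpace ℝ (Fin n), ∑ i, |v i| ≤ 1 →
      ‖iteratedFDeriv ℝ (multiLength β) f x (fun _ => v)‖ ≤ K) :
    ‖multiDeriv β f x‖ ≤ (2 * Real.exp 1) ^ multiLength β * K := by
  obtain ⟨r, hr⟩ : ∃ r : Fin (multiLength β) → Fin n, List.ofFn r = multiIndexList β := by
    rw [← length_multiIndexList]
    exact ⟨_, List.ofFn_get _⟩
  set v : Fin (multiLength β) → EuclideanSpace ℝ (Fin n) :=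
    fun j => EuclideanSpace.single (r j) 1 with hv
  have hsymm (σ : Equiv.Perm (Fin (multiLength β))) :
      iteratedFDeriv ℝ (multiLength β) f x (v ∘ σ) = iteratedFDeriv ℝ (multiLength β) f x v := by
    refine (iteratedFDeriv_single_eq_foldr hf (r ∘ σ) x).trans ?_
    rw [iteratedFDeriv_single_eq_foldr hf,
      foldr_partialDeriv_eq_of_perm hf (Equiv.Perm.ofFn_comp_perm σ r)]
  rw [multiDeriv_eq_foldr, ← hr, ← iteratedFDeriv_single_eq_foldr hf]
  simpa using norm_le_of_forall_norm_diagonal_le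
    (T := (iteratedFDeriv ℝ (multiLength β) f x).toMultilinearMap) hsymm
    convex_setOf_sum_abs_le_one (by simp) (fun j => by simp [hv, apply_ite abs]) hK

end PartialDerivatives

section MixedBounds

variable {n : ℕ}

theorem abs_multiMonomial_le (α : Fin n → ℕ) (x : EuclideanSpace ℝ (Fin n)) :
    |multiMonomial α x| ≤ ‖x.ofLp‖ ^ multiLength α := by
  rw [multiMonomial, Finset.abs_prod, multiLength, ← Finset.prod_pow_eq_pow_sum]
  refine Finset.prod_le_prod (fun _ _ => abs_nonneg _) fun i _ => ?_
  rw [abs_pow]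
  gcongr
  exact norm_le_pi_norm x.ofLp i

theorem exists_abs_multiMonomial_eq [Nonempty (Fin n)] (x : EuclideanSpace ℝ (Fin n)) (Q : ℕ) :
    ∃ α : Fin n → ℕ, multiLength α = Q ∧ |multiMonomial α x| = ‖x.ofLp‖ ^ Q := by
  obtain ⟨i, hi⟩ := Finite.exists_max fun i => ‖x.ofLp i‖
  have hxi : ‖x.ofLp‖ = |x.ofLp i| :=
    le_antisymm ((pi_norm_le_iff_of_nonempty _).mpr hi) (norm_le_pi_norm x.ofLp i)
  refine ⟨Pi.single i Q, by simp [multiLength], ?_⟩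
  rw [multiMonomial, Fintype.prod_eq_single i fun j hj => by rw [Pi.single_eq_of_ne hj, pow_zero],
    Pi.single_eq_same, abs_pow, hxi]

section Decay

variable {F : Type*} [SeminormedAddCommGroup F] {f : EuclideanSpace ℝ (Fin n) → F} {C R : ℝ}
  {Q : ℕ}

theorem max_one_norm_pow_mul_norm_le (hR : 0 ≤ R) (h0 : ∀ y, ‖f y‖ ≤ C)
    (hQ : ∀ α : Fin n → ℕ, multiLength α = Q → ∀ y, |multiMonomial α y| * ‖f y‖ ≤ C * R ^ Q)
    (y : EuclideanSpace ℝ (Fin n)) : max 1 ‖y.ofLp‖ ^ Q * ‖f y‖ ≤ C * max 1 R ^ Q := by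
  have hC : 0 ≤ C := (norm_nonneg _).trans (h0 y)
  rcases le_total ‖y.ofLp‖ 1 with hy | hy
  · rw [max_eq_left hy, one_pow, one_mul]
    exact (h0 y).trans (le_mul_of_one_le_right hC (one_le_pow₀ (le_max_left _ _)))
  · have : Nonempty (Fin n) := by
      by_contra hn
      rw [not_nonempty_iff] at hn
      simp [Subsingleton.elim y.ofLp 0, zero_lt_one.not_ge] at hy
    obtain ⟨α, hα, hαy⟩ := exists_abs_multiMonomial_eq y Q
    rw [max_eq_right hy, ← hαy]
    refine (hQ α hα y).trans ?_
    gcongr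
    exact le_max_right _ _

theorem norm_le_mul_min_one_pow (hR : 0 ≤ R) (h0 : ∀ y, ‖f y‖ ≤ C)
    (hQ : ∀ α : Fin n → ℕ, multiLength α = Q → ∀ y, |multiMonomial α y| * ‖f y‖ ≤ C * R ^ Q)
    {x y : EuclideanSpace ℝ (Fin n)} (hxy : ‖(y - x).ofLp‖ ≤ 1) :
    ‖f y‖ ≤ C * min 1 (2 * max 1 R / max 1 ‖x.ofLp‖) ^ Q := by
  have hC : 0 ≤ C := (norm_nonneg _).trans (h0 y)
  rcases min_choice 1 (2 * max 1 R / max 1 ‖x.ofLp‖) with h | h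
  · rw [h, one_pow, mul_one]
    exact h0 y
  have hX : max 1 ‖x.ofLp‖ ≤ 2 * max 1 ‖y.ofLp‖ := by
    have htri := norm_sub_norm_le x.ofLp y.ofLp
    rw [WithLp.ofLp_sub, norm_sub_rev] at hxy
    refine max_le ?_ ?_ <;> linarith [le_max_left 1 ‖y.ofLp‖, le_max_right 1 ‖y.ofLp‖]
  calc ‖f y‖ ≤ C * max 1 R ^ Q / max 1 ‖y.ofLp‖ ^ Q := by
        rw [le_div_iff₀' (by positivity)]
        exact max_one_norm_pow_mul_norm_le hR h0 hQ y
    _ = C * (2 * max 1 R / (2 * max 1 ‖y.ofLp‖)) ^ Q := by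
        rw [mul_div_mul_left _ _ two_ne_zero, div_pow, mul_div_assoc]
    _ ≤ C * min 1 (2 * max 1 R / max 1 ‖x.ofLp‖) ^ Q := by
        rw [h]
        gcongr

theorem exists_local_bound (hC : 0 < C) (hR : 0 ≤ R) {a : ℕ} (haQ : 2 * a ≤ Q)
    (h0 : ∀ y, ‖f y‖ ≤ C)
    (hQ : ∀ α : Fin n → ℕ, multiLength α = Q → ∀ y, |multiMonomial α y| * ‖f y‖ ≤ C * R ^ Q)
    (x : EuclideanSpace ℝ (Fin n)) :
    ∃ ε, 0 < ε ∧ ε ≤ C ∧ (∀ y : EuclideanSpace ℝ (Fin n), ‖(y - x).ofLp‖ ≤ 1 → ‖f y‖ ≤ ε) ∧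
      ‖x.ofLp‖ ^ a * √(C * ε) ≤ C * (2 * max 1 R) ^ a := by
  set u := min 1 (2 * max 1 R / max 1 ‖x.ofLp‖)
  have hu0 : 0 < u := by positivity
  have hu1 : u ≤ 1 := min_le_left _ _
  have hxu : ‖x.ofLp‖ * u ≤ 2 * max 1 R := by
    calc ‖x.ofLp‖ * u ≤ max 1 ‖x.ofLp‖ * (2 * max 1 R / max 1 ‖x.ofLp‖) := by
          gcongr
          exacts [le_max_right _ _, min_le_right _ _]
      _ = 2 * max 1 R := mul_div_cancel₀ _ (by positivity)
  refine ⟨C * u ^ (2 * a), by positivity, mul_le_of_le_one_right hC.le (pow_le_one₀ hu0.le hu1),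
    fun y hy => ?_, ?_⟩
  · refine (norm_le_mul_min_one_pow hR h0 hQ hy).trans ?_
    gcongr ?_ * ?_
    exact pow_le_pow_of_le_one hu0.le hu1 haQ
  · calc ‖x.ofLp‖ ^ a * √(C * (C * u ^ (2 * a))) = C * (‖x.ofLp‖ * u) ^ a := by
          rw [show C * (C * u ^ (2 * a)) = (C * u ^ a) ^ 2 by ring, Real.sqrt_sq (by positivity)]
          ring
      _ ≤ C * (2 * max 1 R) ^ a := by gcongr

end Decay

variable {𝕜 : Type*} [RCLike 𝕜] {f : EuclideanSpace ℝ (Fin n) → 𝕜}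

theorem norm_iteratedFDeriv_diagonal_le_sqrt (hf : ContDiff ℝ ∞ f) {b N : ℕ} (hN : 1 ≤ N)
    (hbN : 2 * b ≤ N) {ε C S : ℝ} (hε0 : 0 < ε) (hεC : ε ≤ C) (hS : 0 ≤ S)
    {x : EuclideanSpace ℝ (Fin n)}
    (hε : ∀ y : EuclideanSpace ℝ (Fin n), ‖(y - x).ofLp‖ ≤ 1 → ‖f y‖ ≤ ε)
    (hder : ∀ β : Fin n → ℕ, multiLength β = N → ∀ y, ‖multiDeriv β f y‖ ≤ C * S ^ N)
    {v : EuclideanSpace ℝ (Fin n)} (hv : ∑ i, |v i| ≤ 1) :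
    ‖iteratedFDeriv ℝ b f x (fun _ => v)‖ ≤ 2 * (Real.exp 3 * max S N) ^ b * √(C * ε) := by
  have hv1 : ‖v.ofLp‖ ≤ 1 := (pi_norm_le_iff_of_nonneg zero_le_one).mpr fun i =>
    (Finset.single_le_sum (f := fun i => |v i|) (fun _ _ => abs_nonneg _)
      (Finset.mem_univ i)).trans hv
  have hline (m : ℕ) := iteratedDeriv_comp_line (contDiff_infty.mp hf m) x v
  have hC : 0 ≤ C := hε0.le.trans hεC
  have h := norm_iteratedDeriv_zero_le_sqrt (g := fun t : ℝ => f (x + t • v))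
    ((contDiff_infty.mp hf N).comp (by fun_prop)) hN hbN hε0 hεC hS
    (fun t ht => hε _ <| by
      rw [add_sub_cancel_left, WithLp.ofLp_smul, norm_smul]
      exact mul_le_one₀ ht (norm_nonneg _) hv1)
    (fun t _ => by
      rw [hline]
      exact norm_iteratedFDeriv_diagonal_le hf (by positivity) (fun β hβ => hder β hβ _) hv)
  simpa [hline] using h

theorem abs_multiMonomial_mul_norm_multiDeriv_le (hf : ContDiff ℝ ∞ f) {C R S : ℝ} (hC : 0 < C)
    (hR : 0 ≤ R) (hS : 0 ≤ S) {α β : Fin n → ℕ} {Q N : ℕ} (hαQ : 2 * multiLength α ≤ Q)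
    (hN : 1 ≤ N) (hβN : 2 * multiLength β ≤ N) (h0 : ∀ y, ‖f y‖ ≤ C)
    (hmon : ∀ α : Fin n → ℕ, multiLength α = Q → ∀ y, |multiMonomial α y| * ‖f y‖ ≤ C * R ^ Q)
    (hder : ∀ β : Fin n → ℕ, multiLength β = N → ∀ y, ‖multiDeriv β f y‖ ≤ C * S ^ N)
    (x : EuclideanSpace ℝ (Fin n)) :
    |multiMonomial α x| * ‖multiDeriv β f x‖ ≤
      2 * C * ((2 * max 1 R) ^ multiLength α * (2 * Real.exp 4 * max S N) ^ multiLength β) := by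
  obtain ⟨ε, hε0, hεC, hε, hxε⟩ := exists_local_bound hC hR hαQ h0 hmon x
  have hβ : ‖multiDeriv β f x‖ ≤ (2 * Real.exp 1) ^ multiLength β *
      (2 * (Real.exp 3 * max S N) ^ multiLength β * √(C * ε)) :=
    norm_multiDeriv_le_of_diagonal hf fun _ hv =>
      norm_iteratedFDeriv_diagonal_le_sqrt hf hN hβN hε0 hεC hS hε hder hv
  calc |multiMonomial α x| * ‖multiDeriv β f x‖
      ≤ ‖x.ofLp‖ ^ multiLength α * ((2 * Real.exp 1) ^ multiLength β *
        (2 * (Real.exp 3 * max S N) ^ multiLength β * √(C * ε))) := by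
        gcongr
        exact abs_multiMonomial_le α x
    _ = 2 * (2 * Real.exp 4 * max S N) ^ multiLength β *
        (‖x.ofLp‖ ^ multiLength α * √(C * ε)) := by
        rw [show (4 : ℝ) = 1 + 3 by norm_num, Real.exp_add]
        simp only [mul_pow]
        ring
    _ ≤ 2 * (2 * Real.exp 4 * max S N) ^ multiLength β *
        (C * (2 * max 1 R) ^ multiLength α) := by gcongr
    _ = 2 * C * ((2 * max 1 R) ^ multiLength α *
        (2 * Real.exp 4 * max S N) ^ multiLength β) := by ring

end MixedBounds

section WeightSequences

variable {M : ℕ → ℝ}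

theorem weightRoot_zero (M : ℕ → ℝ) : weightRoot M 0 = 1 := by
  simp [weightRoot]

theorem weightRoot_pos {j : ℕ} (hj : 0 < M j) : 0 < weightRoot M j :=
  Real.rpow_pos_of_pos hj _

theorem one_le_weightRoot (hmono : Monotone (weightRoot M)) (j : ℕ) : 1 ≤ weightRoot M j :=
  weightRoot_zero M ▸ hmono j.zero_le

theorem IsWeightSequence.weightRoot_pow (hM : IsWeightSequence M) (j : ℕ) :
    weightRoot M j ^ j = M j := by
  rcases eq_or_ne j 0 with rfl | hj
  · rw [pow_zero, hM.zero]
  · rw [weightRoot, one_div, Real.rpow_inv_natCast_pow (hM.pos j).le hj]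

theorem IsWeightSequence.le_quot_pow (hM : IsWeightSequence M) (j : ℕ) :
    M j ≤ (M (j + 1) / M j) ^ j := by
  induction j with
  | zero => simp [hM.zero]
  | succ j ih =>
    have hq : 0 < M (j + 1) / M j := div_pos (hM.pos _) (hM.pos _)
    calc M (j + 1) = M j * (M (j + 1) / M j) := by rw [mul_div_cancel₀ _ (hM.pos j).ne']
      _ ≤ (M (j + 1) / M j) ^ j * (M (j + 1) / M j) := by gcongr
      _ = (M (j + 1) / M j) ^ (j + 1) := (pow_succ _ _).symm
      _ ≤ (M (j + 2) / M (j + 1)) ^ (j + 1) := by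
        gcongr ?_ ^ _
        exact hM.quot_mono j

theorem IsWeightSequence.monotone_weightRoot (hM : IsWeightSequence M) :
    Monotone (weightRoot M) := by
  refine monotone_nat_of_le_succ fun j => ?_
  rcases eq_or_ne j 0 with rfl | hj
  · simpa [weightRoot] using hM.one_le
  have hpow : M j ^ (j + 1) ≤ M (j + 1) ^ j := by
    have hMj := hM.pos j
    calc M j ^ (j + 1) = M j ^ j * M j := pow_succ _ _
      _ ≤ M j ^ j * (M (j + 1) / M j) ^ j := by
        gcongr
        exact hM.le_quot_pow j
      _ = M (j + 1) ^ j := by rw [← mul_pow, mul_div_cancel₀ _ hMj.ne']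
  refine le_of_pow_le_pow_left₀ (n := j * (j + 1)) (by positivity) (weightRoot_pos (hM.pos _)).le ?_
  rwa [pow_mul, hM.weightRoot_pow, mul_comm j, pow_mul, hM.weightRoot_pow]

theorem IsWeightSequence.exists_weightRoot_two_mul_le (hM : IsWeightSequence M)
    (hmg : HasModerateGrowth M) : ∃ A, ∀ j, weightRoot M (2 * j) ≤ A * weightRoot M j := by
  obtain ⟨C, hC⟩ := hmg
  refine ⟨max C 1, fun j => ?_⟩
  have hmj : 0 < weightRoot M j := weightRoot_pos (hM.pos j)
  rcases Nat.eq_zero_or_pos j with rfl | hj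
  · simp [weightRoot_zero]
  have hquot : M (j + j) / (M j * M j) = (weightRoot M (2 * j) / weightRoot M j) ^ (2 * j) := by
    rw [div_pow, hM.weightRoot_pow, mul_comm 2 j, pow_mul, hM.weightRoot_pow, sq, mul_two]
  have h := hC j j hj hj
  rw [hquot, ← Nat.cast_add, ← two_mul, one_div, Real.pow_rpow_inv_natCast
    (div_pos (weightRoot_pos (hM.pos _)) hmj).le (by lia), div_le_iff₀ hmj] at h
  exact h.trans (by gcongr; exact le_max_left _ _)

theorem IsBaseSequence.exists_index_two_mul_lt {k : ℕ → ℕ} (hk : IsBaseSequence k) {m : ℕ → ℝ}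
    (hpos : ∀ j, 0 < m j) (hmono : Monotone m) (hdouble : ∃ A, ∀ j, m (2 * j) ≤ A * m j)
    (hkm : BddAbove (Set.range fun j : ℕ => m (k (j + 1)) / m (k j))) :
    ∃ H > 0, ∀ c, ∃ j, 2 * c < k j ∧ m (k j) ≤ H * m c := by
  obtain ⟨A, hA⟩ := hdouble
  obtain ⟨B, hB⟩ := hkm
  have hB0 : 0 < B := (div_pos (hpos _) (hpos _)).trans_le (hB (Set.mem_range_self 0))
  have hA0 : 0 < A := pos_of_mul_pos_left ((hpos _).trans_le (hA 0)) (hpos 0).le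
  refine ⟨B * A, by positivity, fun c => ?_⟩
  obtain ⟨j, hj, hcj⟩ : ∃ j, k j ≤ 2 * c ∧ 2 * c < k (j + 1) := by
    have hcover := iUnion_Ico_map_succ_eq_Ici (f := k) (fun j => hk.strictMono.monotone bot_le)
      (not_bddAbove_of_tendsto_atTop hk.strictMono.tendsto_atTop)
    exact mem_iUnion.mp (hcover.ge (hk.zero.trans_le (2 * c).zero_le))
  refine ⟨j + 1, hcj, ?_⟩
  calc m (k (j + 1)) ≤ B * m (k j) := (div_le_iff₀ (hpos _)).mp (hB (Set.mem_range_self j))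
    _ ≤ B * m (2 * c) := by
      gcongr
      exact hmono hj
    _ ≤ B * (A * m c) := by
      gcongr
      exact hA c
    _ = B * A * m c := (mul_assoc _ _ _).symm

end WeightSequences

section Classes

variable {𝕜 : Type*} [RCLike 𝕜] {n : ℕ} {f : EuclideanSpace ℝ (Fin n) → 𝕜} {M : ℕ → ℝ}
  {k l : ℕ → ℕ} {C ρ σ : ℝ}

theorem multiDeriv_eq_self {β : Fin n → ℕ} (hβ : multiLength β = 0)
    (f : EuclideanSpace ℝ (Fin n) → 𝕜) : multiDeriv β f = f := by
  rw [multiDeriv_eq_foldr, List.eq_nil_of_length_eq_zero ((length_multiIndexList β).trans hβ),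
    List.foldr_nil]

theorem LacunaryBound.norm_le (hl : l 0 = 0) (h : LacunaryBound M k l C ρ σ f)
    (x : EuclideanSpace ℝ (Fin n)) : ‖f x‖ ≤ C := by
  have hz : multiLength (0 : Fin n → ℕ) = 0 := by simp [multiLength]
  simpa [multiDeriv_eq_self hz, hl] using (h 0).2 0 (hz.trans hl.symm) x

theorem LacunaryBound.mono (hM : ∀ j, 0 < M j) (hC : 0 ≤ C) (hρ : 0 ≤ ρ) (hσ : 0 ≤ σ) {ρ' σ' : ℝ}
    (hρρ' : ρ ≤ ρ') (hσσ' : σ ≤ σ') (h : LacunaryBound M k l C ρ σ f) :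
    LacunaryBound M k l C ρ' σ' f := by
  have hpos (j : ℕ) : 0 < weightRoot M j := weightRoot_pos (hM j)
  refine fun j => ⟨fun α hα x => ((h j).1 α hα x).trans ?_,
    fun β hβ x => ((h j).2 β hβ x).trans ?_⟩
  · have := hpos (k j)
    gcongr
  · have := hpos (l j)
    gcongr

theorem GelfandShilovBound.exists_lacunaryBound (hM : ∀ j, 0 < M j) (hρ : 0 < ρ) (hσ : 0 < σ)
    (h : GelfandShilovBound M ρ σ f) (k l : ℕ → ℕ) : ∃ C > 0, LacunaryBound M k l C ρ σ f := by
  obtain ⟨C, hC⟩ := h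
  have hz : multiLength (0 : Fin n → ℕ) = 0 := by simp [multiLength]
  have hone (x : EuclideanSpace ℝ (Fin n)) : multiMonomial 0 x = 1 := by simp [multiMonomial]
  have hpos {τ : ℝ} (hτ : 0 < τ) (j : ℕ) : 0 < (τ * weightRoot M j) ^ j :=
    pow_pos (mul_pos hτ (weightRoot_pos (hM j))) j
  refine ⟨max C 1, by positivity, fun j => ⟨fun α hα x => ?_, fun β hβ x => ?_⟩⟩
  · have hα0 := hC α 0 x
    rw [multiDeriv_eq_self hz, hz, pow_zero, mul_one, hα, div_le_iff₀ (hpos hρ _)] at hα0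
    exact hα0.trans (mul_le_mul_of_nonneg_right (le_max_left _ _) (hpos hρ _).le)
  · have h0β := hC 0 β x
    rw [hone, abs_one, one_mul, hz, pow_zero, one_mul, hβ, div_le_iff₀ (hpos hσ _)] at h0β
    exact h0β.trans (mul_le_mul_of_nonneg_right (le_max_left _ _) (hpos hσ _).le)

theorem exists_forall_pow_le_mul_pow_of_eventually_le {u v : ℕ → ℝ} (hu : ∀ a, 0 ≤ u a)
    (hv : ∀ a, 0 < v a) (h : ∀ᶠ a in atTop, u a ≤ v a) : ∃ D > 0, ∀ a, u a ^ a ≤ D * v a ^ a := by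
  have hbdd : IsBoundedUnder (· ≤ ·) atTop fun a => u a ^ a / v a ^ a :=
    ⟨1, eventually_map.mpr <| h.mono fun a ha =>
      div_le_one_of_le₀ (pow_le_pow_left₀ (hu a) ha a) (pow_pos (hv a) a).le⟩
  obtain ⟨D, hD⟩ := hbdd.bddAbove_range
  refine ⟨max D 1, by positivity, fun a => ?_⟩
  rw [← div_le_iff₀ (pow_pos (hv a) a)]
  exact (hD (Set.mem_range_self a)).trans (le_max_left _ _)

theorem LacunaryBound.abs_multiMonomial_mul_norm_multiDeriv_le (hl : l 0 = 0) (hM : ∀ j, 0 < M j)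
    (hf : ContDiff ℝ ∞ f) (hC : 0 < C) (hρ : 0 ≤ ρ) (hσ : 0 ≤ σ) (h : LacunaryBound M k l C ρ σ f)
    {α β : Fin n → ℕ} {i j : ℕ} (hi : 2 * multiLength α < k i) (hj : 2 * multiLength β < l j)
    (x : EuclideanSpace ℝ (Fin n)) :
    |multiMonomial α x| * ‖multiDeriv β f x‖ ≤
      2 * C * ((2 * max 1 (ρ * weightRoot M (k i))) ^ multiLength α *
        (2 * Real.exp 4 * max (σ * weightRoot M (l j)) (l j)) ^ multiLength β) :=
  _root_.abs_multiMonomial_mul_norm_multiDeriv_le hf hC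
    (mul_nonneg hρ (weightRoot_pos (hM _)).le) (mul_nonneg hσ (weightRoot_pos (hM _)).le)
    hi.le (by lia) hj.le (h.norm_le hl) (h i).1 (h j).2 x

theorem exists_gelfandShilovBound_of_lacunaryBound (hk : IsBaseSequence k) (hl : IsBaseSequence l)
    (hM : ∀ j, 0 < M j) (hmono : Monotone (weightRoot M))
    (hdouble : ∃ A, ∀ j, weightRoot M (2 * j) ≤ A * weightRoot M j)
    (hkM : BddAbove (Set.range fun j : ℕ => weightRoot M (k (j + 1)) / weightRoot M (k j)))
    (hlM : BddAbove (Set.range fun j : ℕ => weightRoot M (l (j + 1)) / weightRoot M (l j))) :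
    ∃ A > 0, ∃ B > 0, ∀ {C ρ σ : ℝ} {f : EuclideanSpace ℝ (Fin n) → 𝕜}, ContDiff ℝ ∞ f →
      0 < C → 0 < ρ → 0 < σ → (∀ᶠ j in atTop, 1 ≤ ρ * weightRoot M j) →
      (∀ᶠ j : ℕ in atTop, (j : ℝ) ≤ σ * weightRoot M j) →
      LacunaryBound M k l C ρ σ f → GelfandShilovBound M (A * ρ) (B * σ) f := by
  have hpos (j : ℕ) : 0 < weightRoot M j := weightRoot_pos (hM j)
  obtain ⟨H, hH, hindex⟩ := hk.exists_index_two_mul_lt hpos hmono hdouble hkM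
  obtain ⟨H', hH', hindex'⟩ := hl.exists_index_two_mul_lt hpos hmono hdouble hlM
  choose i hi hiH using hindex
  choose j hj hjH using hindex'
  refine ⟨2 * H, by positivity, 2 * Real.exp 4 * H', by positivity,
    fun {C ρ σ f} hf hC hρ hσ hρ1 hσ1 h => ?_⟩
  have hiTop : Tendsto (fun a => k (i a)) atTop atTop :=
    tendsto_atTop_mono (fun a => by linarith [hi a, id_eq a]) tendsto_id
  have hjTop : Tendsto (fun b => l (j b)) atTop atTop :=
    tendsto_atTop_mono (fun b => by linarith [hj b, id_eq b]) tendsto_id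
  obtain ⟨D, hD, hDα⟩ := exists_forall_pow_le_mul_pow_of_eventually_le
    (u := fun a => 2 * max 1 (ρ * weightRoot M (k (i a))))
    (v := fun a => 2 * H * ρ * weightRoot M a) (fun a => by positivity)
    (fun a => mul_pos (by positivity) (hpos a)) <| (hiTop.eventually hρ1).mono fun a ha => by
      rw [max_eq_right ha]
      linear_combination 2 * ρ * hiH a
  obtain ⟨D', -, hDβ⟩ := exists_forall_pow_le_mul_pow_of_eventually_le
    (u := fun b => 2 * Real.exp 4 * max (σ * weightRoot M (l (j b))) (l (j b)))
    (v := fun b => 2 * Real.exp 4 * H' * σ * weightRoot M b) (fun b => by positivity)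
    (fun b => mul_pos (by positivity) (hpos b)) <| (hjTop.eventually hσ1).mono fun b hb => by
      rw [max_eq_left hb]
      linear_combination 2 * Real.exp 4 * σ * hjH b
  refine ⟨2 * C * (D * D'), fun α β x => ?_⟩
  have hα := hpos (multiLength α)
  have hβ := hpos (multiLength β)
  rw [div_le_iff₀ (by positivity), mul_assoc (2 * C), mul_mul_mul_comm D]
  refine (h.abs_multiMonomial_mul_norm_multiDeriv_le hl.zero hM hf hC hρ.le hσ.le (hi _) (hj _)
    x).trans ?_
  gcongr
  exacts [hDα _, hDβ _]

theorem gelfandShilovRoumieu_subset_lacunaryGelfandShilovRoumieu (hM : ∀ j, 0 < M j)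
    (k l : ℕ → ℕ) :
    gelfandShilovRoumieu 𝕜 n M ⊆ lacunaryGelfandShilovRoumieu 𝕜 n M k l := by
  rintro f ⟨hf, ρ, hρ, σ, hσ, h⟩
  obtain ⟨C, hC, hlac⟩ := h.exists_lacunaryBound hM hρ hσ k l
  exact ⟨hf, C, hC, ρ, hρ, σ, hσ, hlac⟩

theorem gelfandShilovBeurling_subset_lacunaryGelfandShilovBeurling (hM : ∀ j, 0 < M j)
    (k l : ℕ → ℕ) :
    gelfandShilovBeurling 𝕜 n M ⊆ lacunaryGelfandShilovBeurling 𝕜 n M k l :=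
  fun _ ⟨hf, h⟩ => ⟨hf, fun ρ hρ σ hσ => (h ρ hρ σ hσ).exists_lacunaryBound hM hρ hσ k l⟩

theorem lacunaryGelfandShilovRoumieu_subset_gelfandShilovRoumieu (hk : IsBaseSequence k)
    (hl : IsBaseSequence l) (hM : ∀ j, 0 < M j) (hmono : Monotone (weightRoot M))
    (hdouble : ∃ A, ∀ j, weightRoot M (2 * j) ≤ A * weightRoot M j)
    (hkM : BddAbove (Set.range fun j : ℕ => weightRoot M (k (j + 1)) / weightRoot M (k j)))
    (hlM : BddAbove (Set.range fun j : ℕ => weightRoot M (l (j + 1)) / weightRoot M (l j)))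
    (hbdd : BddAbove (Set.range fun j : ℕ => (j : ℝ) / weightRoot M j)) :
    lacunaryGelfandShilovRoumieu 𝕜 n M k l ⊆ gelfandShilovRoumieu 𝕜 n M := by
  obtain ⟨A, hA, B, hB, hGS⟩ := exists_gelfandShilovBound_of_lacunaryBound (𝕜 := 𝕜) (n := n)
    hk hl hM hmono hdouble hkM hlM
  obtain ⟨b, hb⟩ := hbdd
  rintro f ⟨hf, C, hC, ρ, hρ, σ, hσ, h⟩
  have hρ1 (j : ℕ) : 1 ≤ max ρ 1 * weightRoot M j :=
    one_le_mul_of_one_le_of_one_le (le_max_right _ _) (one_le_weightRoot hmono j)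
  have hσb (j : ℕ) : (j : ℝ) ≤ max σ b * weightRoot M j :=
    (div_le_iff₀ (weightRoot_pos (hM j))).mp ((hb (Set.mem_range_self j)).trans (le_max_right _ _))
  exact ⟨hf, A * max ρ 1, by positivity, B * max σ b, by positivity,
    hGS hf hC (by positivity) (by positivity) (.of_forall hρ1) (.of_forall hσb)
      (h.mono hM hC.le hρ.le hσ.le (le_max_left _ _) (le_max_left _ _))⟩

theorem lacunaryGelfandShilovBeurling_subset_gelfandShilovBeurling (hk : IsBaseSequence k)
    (hl : IsBaseSequence l) (hM : ∀ j, 0 < M j) (hmono : Monotone (weightRoot M))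
    (hdouble : ∃ A, ∀ j, weightRoot M (2 * j) ≤ A * weightRoot M j)
    (hkM : BddAbove (Set.range fun j : ℕ => weightRoot M (k (j + 1)) / weightRoot M (k j)))
    (hlM : BddAbove (Set.range fun j : ℕ => weightRoot M (l (j + 1)) / weightRoot M (l j)))
    (hlim : Tendsto (fun j : ℕ => (j : ℝ) / weightRoot M j) atTop (𝓝 0)) :
    lacunaryGelfandShilovBeurling 𝕜 n M k l ⊆ gelfandShilovBeurling 𝕜 n M := by
  obtain ⟨A, hA, B, hB, hGS⟩ := exists_gelfandShilovBound_of_lacunaryBound (𝕜 := 𝕜) (n := n)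
    hk hl hM hmono hdouble hkM hlM
  have hsmall {η : ℝ} (hη : 0 < η) : ∀ᶠ j : ℕ in atTop, (j : ℝ) ≤ η * weightRoot M j :=
    (hlim.eventually_le_const hη).mono fun j hj => (div_le_iff₀ (weightRoot_pos (hM j))).mp hj
  rintro f ⟨hf, h⟩
  refine ⟨hf, fun ρ hρ σ hσ => ?_⟩
  obtain ⟨C, hC, hlac⟩ := h (ρ / A) (by positivity) (σ / B) (by positivity)
  have hone : ∀ᶠ j in atTop, 1 ≤ ρ / A * weightRoot M j := by
    filter_upwards [hsmall (div_pos hρ hA), eventually_ge_atTop 1] with j hj hj1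
    exact (Nat.one_le_cast.mpr hj1).trans hj
  have := hGS hf hC (by positivity) (by positivity) hone (hsmall (by positivity)) hlac
  rwa [mul_div_cancel₀ _ hA.ne', mul_div_cancel₀ _ hB.ne'] at this

end Classes

theorem mainTheorem2_general {𝕜 : Type*} [RCLike 𝕜] (n : ℕ) (k l : ℕ → ℕ) (M : ℕ → ℝ)
    (hk : IsBaseSequence k) (hl : IsBaseSequence l) (hM : ∀ j, 0 < M j)
    (hmono : Monotone (weightRoot M))
    (hdouble : ∃ A, ∀ j, weightRoot M (2 * j) ≤ A * weightRoot M j)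
    (hkM : BddAbove (Set.range fun j : ℕ => weightRoot M (k (j + 1)) / weightRoot M (k j)))
    (hlM : BddAbove (Set.range fun j : ℕ => weightRoot M (l (j + 1)) / weightRoot M (l j))) :
    (BddAbove (Set.range fun j : ℕ => (j : ℝ) / weightRoot M j) →
      lacunaryGelfandShilovRoumieu 𝕜 n M k l = gelfandShilovRoumieu 𝕜 n M) ∧
    (Tendsto (fun j : ℕ => (j : ℝ) / weightRoot M j) atTop (𝓝 0) →
      lacunaryGelfandShilovBeurling 𝕜 n M k l = gelfandShilovBeurling 𝕜 n M) :=
  ⟨fun hbdd => (lacunaryGelfandShilovRoumieu_subset_gelfandShilovRoumieu hk hl hM hmono hdouble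
      hkM hlM hbdd).antisymm (gelfandShilovRoumieu_subset_lacunaryGelfandShilovRoumieu hM k l),
    fun hlim => (lacunaryGelfandShilovBeurling_subset_gelfandShilovBeurling hk hl hM hmono hdouble
      hkM hlM hlim).antisymm (gelfandShilovBeurling_subset_lacunaryGelfandShilovBeurling hM k l)⟩

theorem mainTheorem2 {𝕜 : Type*} [RCLike 𝕜] (n : ℕ) (k l : ℕ → ℕ) (M : ℕ → ℝ)
    (hk : IsBaseSequence k) (hl : IsBaseSequence l)
    (hM : IsWeightSequence M) (hmg : HasModerateGrowth M)
    (hkM : BddAbove (Set.range fun j : ℕ => weightRoot M (k (j + 1)) / weightRoot M (k j)))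
    (hlM : BddAbove (Set.range fun j : ℕ => weightRoot M (l (j + 1)) / weightRoot M (l j))) :
    (BddAbove (Set.range fun j : ℕ => (j : ℝ) / weightRoot M j) →
      lacunaryGelfandShilovRoumieu 𝕜 n M k l = gelfandShilovRoumieu 𝕜 n M) ∧
    (Tendsto (fun j : ℕ => (j : ℝ) / weightRoot M j) atTop (𝓝 0) →
      lacunaryGelfandShilovBeurling 𝕜 n M k l = gelfandShilovBeurling 𝕜 n M) :=
  mainTheorem2_general n k l M hk hl hM.pos hM.monotone_weightRoot
    (hM.exists_weightRoot_two_mul_le hmg) hkM hlM
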